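/- For an integer $n\ge 1$ let $G_n$ be the polyomino graph with $4n$ squares whose vertices are $u_i,v_i$ $(0\le i\le 2n)$ and $w_i,z_i$ $(1\le i\le 2n)$, and whose edges are $u_{i-1}u_i$ and $v_{i-1}v_i$ $(1\le i\le 2n)$, $u_iv_i$ $(0\le i\le 2n)$, $w_iu_i$ and $v_iz_i$ $(1\le i\le 2n)$, and $w_{2k-1}w_{2k}$ and $z_{2k-1}z_{2k}$ $(1\le k\le n)$; let $G_0$ be the null graph (no vertices). For a perfect matching $M$ of a finite graph $G$, a forcing set of $M$ is a subset $S\subseteq M$ that is contained in no perfect matching of $G$ other than $M$; the forcing number $f(G,M)$ is the minimum size of a forcing set of $M$. The forcing spectrum $\mathrm{Spec}_f(G)$ is the set of the numbers $f(G,M)$ over all perfect matchings $M$ of $G$; its minimum and maximum are denoted by $f(G)$ and $F(G)$. Then, for every integer $n\ge 0$: 1. $f(G_n)=n$ and $F(G_n)=2n$; 2. $\mathrm{Spec}_f(G_n)=\{n,n+1,\dots,2n\}$. -/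

import Mathlib

namespace ForcingSpectrum

/-- An edge set `S` is a forcing set of the perfect matching `M` of `G` if `S` is contained in `M`
and no other perfect matching of `G` contains `S`. -/
def IsForcingSet {V : Type*} {G : SimpleGraph V} (M : G.Subgraph) (S : Set (Sym2 V)) : Prop :=
  S ⊆ M.edgeSet ∧ ∀ M' : G.Subgraph, M'.IsPerfectMatching → S ⊆ M'.edgeSet → M' = M

/-- The forcing number of a perfect matching `M` of a finite graph: the size of a minimum forcing
set. (If the graph is finite, the edge set of `M` is itself a finite forcing set, so the infimum is
a minimum.) -/
noncomputable def forcingNumber {V : Type*} {G : SimpleGraph V} (M : G.Subgraph) : ℕ :=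
  sInf {k : ℕ | ∃ S : Finset (Sym2 V), IsForcingSet M (S : Set (Sym2 V)) ∧ S.card = k}

/-- The forcing spectrum: the set of forcing numbers of all perfect matchings. -/
def forcingSpectrum {V : Type*} (G : SimpleGraph V) : Set ℕ :=
  {k : ℕ | ∃ M : G.Subgraph, M.IsPerfectMatching ∧ forcingNumber M = k}

/-- Labels of the lattice points in four rows, `w` above `u` above `v` above `z`;
the index is the column. -/
inductive Label : Type
  | w (i : ℕ) : Label
  | u (i : ℕ) : Label
  | v (i : ℕ) : Label
  | z (i : ℕ) : Label

/-- Edges of the one-way infinite strip, each listed once: the two middle rows and the columns are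
full paths; in the outer rows only columns `2k+1` and `2k+2` are joined. -/
inductive StripEdge : Label → Label → Prop
  | uu (i : ℕ) : StripEdge (Label.u i) (Label.u (i + 1))
  | vv (i : ℕ) : StripEdge (Label.v i) (Label.v (i + 1))
  | wu (i : ℕ) : StripEdge (Label.w i) (Label.u i)
  | uv (i : ℕ) : StripEdge (Label.u i) (Label.v i)
  | vz (i : ℕ) : StripEdge (Label.v i) (Label.z i)
  | ww (k : ℕ) : StripEdge (Label.w (2 * k + 1)) (Label.w (2 * k + 2))
  | zz (k : ℕ) : StripEdge (Label.z (2 * k + 1)) (Label.z (2 * k + 2))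

/-- The labels that are vertices of `G_n`: `u_i`, `v_i` for `0 ≤ i ≤ 2n`, and `w_i`, `z_i` for
`1 ≤ i ≤ 2n`. There are none if `n = 0`, as `G_0` is the null graph. -/
def IsVertex (n : ℕ) : Label → Prop
  | Label.w i => 1 ≤ i ∧ i ≤ 2 * n
  | Label.u i => 0 < n ∧ i ≤ 2 * n
  | Label.v i => 0 < n ∧ i ≤ 2 * n
  | Label.z i => 1 ≤ i ∧ i ≤ 2 * n

/-- The polyomino graph `G_n` with `4n` squares: a straight horizontal chain of `2n` squares
`u_{i-1} u_i v_i v_{i-1}`, where for every `k = 1, …, n` the `2k`-th square of the chain has one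
further square attached above it (`w_{2k-1} w_{2k} u_{2k} u_{2k-1}`) and one below it
(`v_{2k-1} v_{2k} z_{2k} z_{2k-1}`). -/
def polyominoGraph (n : ℕ) : SimpleGraph {a : Label // IsVertex n a} where
  Adj a b := StripEdge a.1 b.1 ∨ StripEdge b.1 a.1
  symm := ⟨fun _ _ h => Or.symm h⟩
  loopless := ⟨fun a h => by
    have key : ∀ x y : Label, StripEdge x y → x ≠ y := by
      intro x y hxy
      cases hxy <;> simp
    exact h.elim (fun h => key _ _ h rfl) (fun h => key _ _ h rfl)⟩

end ForcingSpectrum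

/-! Call columns `2k+1` and `2k+2` block `k`, and the edges from column `2k` to column `2k+1` links.
The degree equations show that a perfect matching `M` contains both links at a given place or
neither (`ind_link_eq`).

Upper bound: the edges of `M` at all `u_{2k+1}` and `v_{2k+2}` determine `M`, and the edge at
`v_{2k+2}` can be spared when `u_{2k+1} v_{2k+1}` is in `M` (`eq_of_agree`). With at most `j` blocks
not spared this gives a forcing set of at most `n + j` edges.

Lower bound: a forcing set meets each square with two opposite sides in `M`, since otherwise these
sides could be switched. A scan over the blocks finds `k` edges up to column `2k`
(`edgeCount_lower_bound`).

Interpolation: take the matching that is horizontal in the first `j` blocks and has `u_i v_i` in all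
other columns. It has two alternating squares in each of the first `j` blocks and one in each other
block, all disjoint, so its forcing number is exactly `n + j`. -/

namespace ForcingSpectrum

open Finset

/-! ### Alternating squares -/

/-- Two perfect matchings, one of whose adjacency relations refines the other, agree. -/
theorem perfectMatching_eq_of_adj {V : Type*} {G : SimpleGraph V} {M M' : G.Subgraph}
    (hM : M.IsPerfectMatching) (hM' : M'.IsPerfectMatching)
    (h : ∀ a b, M.Adj a b → M'.Adj a b) : M' = M := by
  rw [SimpleGraph.Subgraph.isPerfectMatching_iff] at hM hM'
  have hadj : ∀ a b, M'.Adj a b ↔ M.Adj a b := by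
    intro a b
    refine ⟨fun hab => ?_, h a b⟩
    obtain ⟨c, hc, -⟩ := hM a
    rwa [(hM' a).unique hab (h a c hc)]
  refine SimpleGraph.Subgraph.ext ?_ (by ext a b; exact hadj a b)
  ext a
  obtain ⟨c, hc, -⟩ := hM a
  exact ⟨fun _ => M.edge_vert hc, fun _ => M'.edge_vert (h _ _ hc)⟩

/-- A forcing set contains an edge of every alternating square. -/
theorem IsForcingSet.mem_of_alternating_square {V : Type*} {G : SimpleGraph V} {M : G.Subgraph}
    {S : Set (Sym2 V)} (hS : IsForcingSet M S) (hM : M.IsPerfectMatching) {a b c d : V}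
    (hab : M.Adj a b) (hcd : M.Adj c d) (hbc : G.Adj b c) (hda : G.Adj d a) (hac : a ≠ c) :
    s(a, b) ∈ S ∨ s(c, d) ∈ S := by
  by_contra! hcon
  have hpm := SimpleGraph.Subgraph.isPerfectMatching_iff.1 hM
  have huniq : ∀ {x y z : V}, M.Adj x y → M.Adj x z → y = z :=
    fun {x y z} h h' => (hpm x).unique h h'
  have hbd : b ≠ d := fun h => hac (huniq hab.symm (h ▸ hcd.symm))
  have hbc' := hbc.ne
  have hda' := hda.ne
  have hab' := hab.adj_sub.ne
  have hcd' := hcd.adj_sub.ne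
  -- Switch the square: replace `ab`, `cd` by `bc`, `da`. As `S` contains neither removed edge, it
  -- survives in `M'`.
  let M' : G.Subgraph :=
    { verts := Set.univ
      Adj := fun x y => (M.Adj x y ∧ x ≠ a ∧ x ≠ b ∧ x ≠ c ∧ x ≠ d) ∨ (x = b ∧ y = c) ∨
        (x = c ∧ y = b) ∨ (x = d ∧ y = a) ∨ (x = a ∧ y = d)
      adj_sub := by
        rintro x y (⟨h, -⟩ | ⟨rfl, rfl⟩ | ⟨rfl, rfl⟩ | ⟨rfl, rfl⟩ | ⟨rfl, rfl⟩)
        exacts [h.adj_sub, hbc, hbc.symm, hda, hda.symm]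
      edge_vert := fun _ => Set.mem_univ _
      symm := ⟨by
        rintro x y (⟨h, h1, h2, h3, h4⟩ | h | h | h | h)
        · refine Or.inl ⟨h.symm, ?_, ?_, ?_, ?_⟩
          · rintro rfl; exact h2 (huniq h.symm hab)
          · rintro rfl; exact h1 (huniq h.symm hab.symm)
          · rintro rfl; exact h4 (huniq h.symm hcd)
          · rintro rfl; exact h3 (huniq h.symm hcd.symm)
        all_goals tauto⟩ }
  have hM' : M'.IsPerfectMatching := by
    rw [SimpleGraph.Subgraph.isPerfectMatching_iff]
    intro x
    obtain ⟨y, hy, hy'⟩ := hpm x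
    by_cases h1 : x = a
    · exact ⟨d, by simp [M', h1], by
        rintro z (h | h | h | h | h) <;> grind⟩
    by_cases h2 : x = b
    · exact ⟨c, by simp [M', h2], by
        rintro z (h | h | h | h | h) <;> grind⟩
    by_cases h3 : x = c
    · exact ⟨b, by simp [M', h3], by
        rintro z (h | h | h | h | h) <;> grind⟩
    by_cases h4 : x = d
    · exact ⟨a, by simp [M', h4], by
        rintro z (h | h | h | h | h) <;> grind⟩
    refine ⟨y, Or.inl ⟨hy, h1, h2, h3, h4⟩, ?_⟩
    rintro z (h | h | h | h | h)
    · exact hy' z h.1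
    all_goals grind
  have hsub : S ⊆ M'.edgeSet := by
    intro e he
    have heM := hS.1 he
    induction e using Sym2.ind with
    | _ x y =>
      rw [SimpleGraph.Subgraph.mem_edgeSet] at heM ⊢
      refine Or.inl ⟨heM, ?_, ?_, ?_, ?_⟩
      · rintro rfl; exact hcon.1 (huniq heM hab ▸ he)
      · rintro rfl; exact hcon.1 (Sym2.eq_swap ▸ huniq heM hab.symm ▸ he)
      · rintro rfl; exact hcon.2 (huniq heM hcd ▸ he)
      · rintro rfl; exact hcon.2 (Sym2.eq_swap ▸ huniq heM hcd.symm ▸ he)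
  have hadj : M'.Adj b c := Or.inr (Or.inl ⟨rfl, rfl⟩)
  rw [hS.2 M' hM' hsub] at hadj
  exact hac (huniq hab.symm hadj)

/-! ### Matchings of the polyomino graph, seen on labels -/

section Labels

variable {n : ℕ}

/-- Adjacency in a subgraph of `G_n`, as a relation on labels. -/
def LabelAdj (M : (polyominoGraph n).Subgraph) (a b : Label) : Prop :=
  ∃ (ha : IsVertex n a) (hb : IsVertex n b), M.Adj ⟨a, ha⟩ ⟨b, hb⟩

open Classical in
/-- The indicator of the adjacency relation on labels. -/
noncomputable def ind (M : (polyominoGraph n).Subgraph) (a b : Label) : ℕ :=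
  if LabelAdj M a b then 1 else 0

variable {M M' : (polyominoGraph n).Subgraph}

theorem LabelAdj.symm {a b : Label} (h : LabelAdj M a b) : LabelAdj M b a :=
  let ⟨ha, hb, hab⟩ := h
  ⟨hb, ha, hab.symm⟩

theorem LabelAdj.strip {a b : Label} (h : LabelAdj M a b) : StripEdge a b ∨ StripEdge b a :=
  let ⟨_, _, hab⟩ := h
  hab.adj_sub

theorem ind_eq_one_iff {a b : Label} : ind M a b = 1 ↔ LabelAdj M a b := by
  unfold ind; split_ifs <;> simp_all

theorem ind_comm (a b : Label) : ind M a b = ind M b a := by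
  classical
  unfold ind
  exact if_congr ⟨LabelAdj.symm, LabelAdj.symm⟩ rfl rfl

theorem ind_le_one (a b : Label) : ind M a b ≤ 1 := by
  unfold ind; split_ifs <;> simp

theorem ind_eq_zero_of_not {a b : Label} (h : ¬ LabelAdj M a b) : ind M a b = 0 := if_neg h

theorem exists_labelAdj (hM : M.IsPerfectMatching) {a : Label} (ha : IsVertex n a) :
    ∃ b, LabelAdj M a b ∧ ∀ c, LabelAdj M a c → c = b := by
  obtain ⟨⟨b, hb⟩, h, h'⟩ := SimpleGraph.Subgraph.isPerfectMatching_iff.1 hM ⟨a, ha⟩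
  refine ⟨b, ⟨ha, hb, h⟩, ?_⟩
  rintro c ⟨_, hc, hac⟩
  exact congrArg Subtype.val (h' ⟨c, hc⟩ hac)

theorem ind_of_forall_eq {a b : Label} (hab : LabelAdj M a b) (h : ∀ c, LabelAdj M a c → c = b)
    [DecidableEq Label] (c : Label) : ind M a c = if c = b then 1 else 0 := by
  classical
  unfold ind
  exact if_congr ⟨h c, fun hc => hc ▸ hab⟩ rfl rfl

/-! ### Neighbourhoods and degree equations -/

theorem strip_w {i : ℕ} {b : Label} (h : StripEdge (.w i) b ∨ StripEdge b (.w i)) :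
    b = .u i ∨ (∃ k, i = 2 * k + 1 ∧ b = .w (2 * k + 2)) ∨
      ∃ k, i = 2 * k + 2 ∧ b = .w (2 * k + 1) := by
  rcases h with h | h <;> cases h <;> simp

theorem strip_z {i : ℕ} {b : Label} (h : StripEdge (.z i) b ∨ StripEdge b (.z i)) :
    b = .v i ∨ (∃ k, i = 2 * k + 1 ∧ b = .z (2 * k + 2)) ∨
      ∃ k, i = 2 * k + 2 ∧ b = .z (2 * k + 1) := by
  rcases h with h | h <;> cases h <;> simp

theorem strip_u {i : ℕ} {b : Label} (h : StripEdge (.u i) b ∨ StripEdge b (.u i)) :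
    b = .u (i + 1) ∨ (∃ k, i = k + 1 ∧ b = .u k) ∨ b = .w i ∨ b = .v i := by
  rcases h with h | h <;> cases h <;> simp

theorem strip_v {i : ℕ} {b : Label} (h : StripEdge (.v i) b ∨ StripEdge b (.v i)) :
    b = .v (i + 1) ∨ (∃ k, i = k + 1 ∧ b = .v k) ∨ b = .z i ∨ b = .u i := by
  rcases h with h | h <;> cases h <;> simp

theorem sum_ind_w_left (hM : M.IsPerfectMatching) {k : ℕ} (hk : k < n) :
    ind M (.w (2 * k + 1)) (.w (2 * k + 2)) + ind M (.w (2 * k + 1)) (.u (2 * k + 1)) = 1 := by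
  classical
  obtain ⟨b, hb, hb'⟩ := exists_labelAdj hM (a := .w (2 * k + 1)) (by simp only [IsVertex]; omega)
  simp only [ind_of_forall_eq hb hb']
  obtain rfl | ⟨l, hl, rfl⟩ | ⟨l, hl, rfl⟩ := strip_w hb.strip
  · simp
  · obtain rfl : k = l := by omega
    simp
  · omega

theorem sum_ind_w_right (hM : M.IsPerfectMatching) {k : ℕ} (hk : k < n) :
    ind M (.w (2 * k + 1)) (.w (2 * k + 2)) + ind M (.w (2 * k + 2)) (.u (2 * k + 2)) = 1 := by
  classical
  obtain ⟨b, hb, hb'⟩ := exists_labelAdj hM (a := .w (2 * k + 2)) (by simp only [IsVertex]; omega)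
  rw [ind_comm (.w (2 * k + 1))]
  simp only [ind_of_forall_eq hb hb']
  obtain rfl | ⟨l, hl, rfl⟩ | ⟨l, hl, rfl⟩ := strip_w hb.strip
  · simp
  · omega
  · obtain rfl : k = l := by omega
    simp

theorem sum_ind_z_left (hM : M.IsPerfectMatching) {k : ℕ} (hk : k < n) :
    ind M (.z (2 * k + 1)) (.z (2 * k + 2)) + ind M (.v (2 * k + 1)) (.z (2 * k + 1)) = 1 := by
  classical
  obtain ⟨b, hb, hb'⟩ := exists_labelAdj hM (a := .z (2 * k + 1)) (by simp only [IsVertex]; omega)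
  rw [ind_comm (.v (2 * k + 1))]
  simp only [ind_of_forall_eq hb hb']
  obtain rfl | ⟨l, hl, rfl⟩ | ⟨l, hl, rfl⟩ := strip_z hb.strip
  · simp
  · obtain rfl : k = l := by omega
    simp
  · omega

theorem sum_ind_z_right (hM : M.IsPerfectMatching) {k : ℕ} (hk : k < n) :
    ind M (.z (2 * k + 1)) (.z (2 * k + 2)) + ind M (.v (2 * k + 2)) (.z (2 * k + 2)) = 1 := by
  classical
  obtain ⟨b, hb, hb'⟩ := exists_labelAdj hM (a := .z (2 * k + 2)) (by simp only [IsVertex]; omega)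
  rw [ind_comm (.v (2 * k + 2)), ind_comm (.z (2 * k + 1))]
  simp only [ind_of_forall_eq hb hb']
  obtain rfl | ⟨l, hl, rfl⟩ | ⟨l, hl, rfl⟩ := strip_z hb.strip
  · simp
  · omega
  · obtain rfl : k = l := by omega
    simp

/-- At the last column `i + 1 = 2 * n` the label `u (i + 2)` is not a vertex and its term is zero,
so no separate boundary equation is needed. -/
theorem sum_ind_u (hM : M.IsPerfectMatching) {i : ℕ} (hi : i + 1 ≤ 2 * n) :
    ind M (.u i) (.u (i + 1)) + ind M (.u (i + 1)) (.u (i + 2)) +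
      ind M (.w (i + 1)) (.u (i + 1)) + ind M (.u (i + 1)) (.v (i + 1)) = 1 := by
  classical
  obtain ⟨b, hb, hb'⟩ := exists_labelAdj hM (a := .u (i + 1)) (by simp only [IsVertex]; omega)
  rw [ind_comm (.u i), ind_comm (.w (i + 1))]
  simp only [ind_of_forall_eq hb hb']
  obtain rfl | ⟨l, hl, rfl⟩ | rfl | rfl := strip_u hb.strip
  · simp [show ¬ i = i + 1 + 1 by omega]
  · obtain rfl : i = l := by omega
    simp
  · simp
  · simp

theorem sum_ind_v (hM : M.IsPerfectMatching) {i : ℕ} (hi : i + 1 ≤ 2 * n) :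
    ind M (.v i) (.v (i + 1)) + ind M (.v (i + 1)) (.v (i + 2)) +
      ind M (.v (i + 1)) (.z (i + 1)) + ind M (.u (i + 1)) (.v (i + 1)) = 1 := by
  classical
  obtain ⟨b, hb, hb'⟩ := exists_labelAdj hM (a := .v (i + 1)) (by simp only [IsVertex]; omega)
  rw [ind_comm (.v i), ind_comm (.u (i + 1))]
  simp only [ind_of_forall_eq hb hb']
  obtain rfl | ⟨l, hl, rfl⟩ | rfl | rfl := strip_v hb.strip
  · simp [show ¬ i = i + 1 + 1 by omega]
  · obtain rfl : i = l := by omega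
    simp
  · simp
  · simp

theorem sum_ind_u_zero (hM : M.IsPerfectMatching) (hn : 0 < n) :
    ind M (.u 0) (.u 1) + ind M (.u 0) (.v 0) = 1 := by
  classical
  obtain ⟨b, hb, hb'⟩ := exists_labelAdj hM (a := .u 0) (by simp only [IsVertex]; omega)
  simp only [ind_of_forall_eq hb hb']
  obtain rfl | ⟨l, hl, rfl⟩ | rfl | rfl := strip_u hb.strip
  · simp
  · omega
  · obtain ⟨-, h, -⟩ := hb
    simp [IsVertex] at h
  · simp

theorem sum_ind_v_zero (hM : M.IsPerfectMatching) (hn : 0 < n) :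
    ind M (.v 0) (.v 1) + ind M (.u 0) (.v 0) = 1 := by
  classical
  obtain ⟨b, hb, hb'⟩ := exists_labelAdj hM (a := .v 0) (by simp only [IsVertex]; omega)
  rw [ind_comm (.u 0)]
  simp only [ind_of_forall_eq hb hb']
  obtain rfl | ⟨l, hl, rfl⟩ | rfl | rfl := strip_v hb.strip
  · simp
  · omega
  · obtain ⟨-, h, -⟩ := hb
    simp [IsVertex] at h
  · simp

/-- Between two blocks a perfect matching uses both horizontal edges or none. -/
theorem ind_link_eq (hM : M.IsPerfectMatching) (hn : 0 < n) {k : ℕ} (hk : k ≤ n) :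
    ind M (.u (2 * k)) (.u (2 * k + 1)) = ind M (.v (2 * k)) (.v (2 * k + 1)) := by
  induction k with
  | zero =>
    have h1 := sum_ind_u_zero hM hn
    have h2 := sum_ind_v_zero hM hn
    simp only [mul_zero, zero_add]
    omega
  | succ k ih =>
    have ih := ih (by omega)
    have h1 := sum_ind_w_left hM (k := k) (by omega)
    have h2 := sum_ind_w_right hM (k := k) (by omega)
    have h3 := sum_ind_z_left hM (k := k) (by omega)
    have h4 := sum_ind_z_right hM (k := k) (by omega)
    have h5 := sum_ind_u hM (i := 2 * k) (by omega)
    have h6 := sum_ind_u hM (i := 2 * k + 1) (by omega)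
    have h7 := sum_ind_v hM (i := 2 * k) (by omega)
    have h8 := sum_ind_v hM (i := 2 * k + 1) (by omega)
    simp only [mul_add, mul_one, add_assoc, Nat.reduceAdd] at *
    -- The `w` equations make both edges `wu` of the block equally present. Subtracting the two `u`
    -- equations gives left link minus right link = second `uv` minus first `uv`. The lower half
    -- gives the same difference, so equality of links propagates.
    omega

theorem ind_link_last : ind M (.u (2 * n)) (.u (2 * n + 1)) = 0 := by
  refine ind_eq_zero_of_not ?_
  rintro ⟨-, h, -⟩
  simp only [IsVertex] at h
  omega

end Labels

/-! ### Upper bound: small forcing sets -/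

section Upper

variable {n : ℕ} {M M' : (polyominoGraph n).Subgraph}

theorem ind_eq_of_common_edge (hM : M.IsPerfectMatching) (hM' : M'.IsPerfectMatching)
    {a b : Label} (h : LabelAdj M a b) (h' : LabelAdj M' a b) (c : Label) :
    ind M a c = ind M' a c := by
  classical
  obtain ⟨d, hd, hd'⟩ := exists_labelAdj hM h.1
  obtain ⟨d', hdd, hdd'⟩ := exists_labelAdj hM' h.1
  obtain rfl := hd' b h
  obtain rfl := hdd' b h'
  rw [ind_of_forall_eq hd hd', ind_of_forall_eq hdd hdd']

/-- Two perfect matchings that agree at all `u_{2k+1}`, and at `v_{2k+2}` unless the first one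
contains `u_{2k+1} v_{2k+1}`, are equal. -/
theorem eq_of_agree (hM : M.IsPerfectMatching) (hM' : M'.IsPerfectMatching)
    (hu : ∀ k < n, ∀ c, ind M (.u (2 * k + 1)) c = ind M' (.u (2 * k + 1)) c)
    (hv : ∀ k < n, ind M (.u (2 * k + 1)) (.v (2 * k + 1)) = 1 ∨
      ∀ c, ind M (.v (2 * k + 2)) c = ind M' (.v (2 * k + 2)) c) : M' = M := by
  have hlink : ∀ k ≤ n, ind M (.u (2 * k)) (.u (2 * k + 1)) =
      ind M' (.u (2 * k)) (.u (2 * k + 1)) := by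
    intro k hk
    rcases hk.lt_or_eq with hk | rfl
    · rw [ind_comm, hu k hk, ind_comm]
    · rw [ind_link_last, ind_link_last]
  have huv : ∀ k < n, ind M (.u (2 * k + 2)) (.v (2 * k + 2)) =
      ind M' (.u (2 * k + 2)) (.v (2 * k + 2)) ∧
      ind M (.v (2 * k + 1)) (.v (2 * k + 2)) = ind M' (.v (2 * k + 1)) (.v (2 * k + 2)) ∧
      ind M (.v (2 * k + 2)) (.z (2 * k + 2)) = ind M' (.v (2 * k + 2)) (.z (2 * k + 2)) := by
    intro k hk
    rcases hv k hk with h | h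
    -- Since `u_{2k+1} v_{2k+1}` lies in both matchings, both outer horizontal edges are forced.
    -- Only the right link remains free at column `2k+2`, and `hlink` settles it.
    · have e1 := hu k hk (.v (2 * k + 1))
      have e2 := hu k hk (.u (2 * k + 2))
      have e3 := hu k hk (.w (2 * k + 1))
      rw [ind_comm _ (.w _), ind_comm _ (.w _)] at e3
      have l0 := hlink k hk.le
      have l1 := hlink (k + 1) hk
      have := sum_ind_u hM (i := 2 * k) (by omega)
      have := sum_ind_u hM (i := 2 * k + 1) (by omega)
      have := sum_ind_v hM (i := 2 * k) (by omega)
      have := sum_ind_v hM (i := 2 * k + 1) (by omega)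
      have := sum_ind_w_left hM hk
      have := sum_ind_w_right hM hk
      have := sum_ind_z_left hM hk
      have := sum_ind_z_right hM hk
      have := sum_ind_u hM' (i := 2 * k) (by omega)
      have := sum_ind_u hM' (i := 2 * k + 1) (by omega)
      have := sum_ind_v hM' (i := 2 * k) (by omega)
      have := sum_ind_v hM' (i := 2 * k + 1) (by omega)
      have := sum_ind_w_left hM' hk
      have := sum_ind_w_right hM' hk
      have := sum_ind_z_left hM' hk
      have := sum_ind_z_right hM' hk
      simp only [mul_add, mul_one, add_assoc, Nat.reduceAdd] at *
      omega
    · refine ⟨?_, ?_, h _⟩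
      · rw [ind_comm, h, ind_comm]
      · rw [ind_comm, h, ind_comm]
  -- The lower links follow from the upper ones by `ind_link_eq`; in each outer square one `wu` or
  -- `vz` edge determines the other edges.
  have hblock : ∀ k < n,
      ind M (.v (2 * k)) (.v (2 * k + 1)) = ind M' (.v (2 * k)) (.v (2 * k + 1)) ∧
      ind M (.w (2 * k + 1)) (.w (2 * k + 2)) = ind M' (.w (2 * k + 1)) (.w (2 * k + 2)) ∧
      ind M (.z (2 * k + 1)) (.z (2 * k + 2)) = ind M' (.z (2 * k + 1)) (.z (2 * k + 2)) ∧
      ind M (.w (2 * k + 1)) (.u (2 * k + 1)) = ind M' (.w (2 * k + 1)) (.u (2 * k + 1)) ∧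
      ind M (.w (2 * k + 2)) (.u (2 * k + 2)) = ind M' (.w (2 * k + 2)) (.u (2 * k + 2)) ∧
      ind M (.v (2 * k + 1)) (.z (2 * k + 1)) = ind M' (.v (2 * k + 1)) (.z (2 * k + 1)) := by
    intro k hk
    have e3 := hu k hk (.w (2 * k + 1))
    rw [ind_comm _ (.w _), ind_comm _ (.w _)] at e3
    obtain ⟨-, -, e4⟩ := huv k hk
    have l0 := hlink k hk.le
    have p := ind_link_eq hM (by omega) hk.le
    have p' := ind_link_eq hM' (by omega) hk.le
    have := sum_ind_w_left hM hk
    have := sum_ind_w_right hM hk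
    have := sum_ind_z_left hM hk
    have := sum_ind_z_right hM hk
    have := sum_ind_w_left hM' hk
    have := sum_ind_w_right hM' hk
    have := sum_ind_z_left hM' hk
    have := sum_ind_z_right hM' hk
    omega
  have key : ∀ a b, StripEdge a b → LabelAdj M a b → LabelAdj M' a b := by
    intro a b hab h
    have hab' := h
    obtain ⟨ha, hb, -⟩ := hab'
    rw [← ind_eq_one_iff] at h ⊢
    rw [← h]
    symm
    cases hab with
    | uu i =>
      simp only [IsVertex] at ha hb
      obtain ⟨k, rfl | rfl⟩ := i.even_or_odd'
      · exact hlink k (by omega)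
      · exact hu k (by omega) _
    | vv i =>
      simp only [IsVertex] at ha hb
      obtain ⟨k, rfl | rfl⟩ := i.even_or_odd'
      · exact (hblock k (by omega)).1
      · exact (huv k (by omega)).2.1
    | uv i =>
      simp only [IsVertex] at ha hb
      -- Column 0 lies in no block; there `uv` is the complement of the first link.
      rcases i.eq_zero_or_pos with rfl | hi
      · have := sum_ind_u_zero hM (by omega)
        have := sum_ind_u_zero hM' (by omega)
        have h0 := hlink 0 (by omega)
        simp only [mul_zero, zero_add] at h0
        omega
      · obtain ⟨i, rfl⟩ := Nat.exists_eq_add_of_lt hi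
        rw [zero_add] at *
        obtain ⟨k, rfl | rfl⟩ := i.even_or_odd'
        · exact hu k (by omega) _
        · exact (huv k (by omega)).1
    | wu i =>
      simp only [IsVertex] at ha hb
      obtain ⟨i, rfl⟩ := Nat.exists_eq_add_of_le' ha.1
      obtain ⟨k, rfl | rfl⟩ := i.even_or_odd'
      · exact (hblock k (by omega)).2.2.2.1
      · exact (hblock k (by omega)).2.2.2.2.1
    | vz i =>
      simp only [IsVertex] at ha hb
      obtain ⟨i, rfl⟩ := Nat.exists_eq_add_of_le' hb.1
      obtain ⟨k, rfl | rfl⟩ := i.even_or_odd'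
      · exact (hblock k (by omega)).2.2.2.2.2
      · exact (huv k (by omega)).2.2
    | ww k =>
      simp only [IsVertex] at ha hb
      exact (hblock k (by omega)).2.1
    | zz k =>
      simp only [IsVertex] at ha hb
      exact (hblock k (by omega)).2.2.1
  refine perfectMatching_eq_of_adj hM hM' fun a b hab => ?_
  have hl : LabelAdj M a.1 b.1 := ⟨a.2, b.2, hab⟩
  have hl' : LabelAdj M' a.1 b.1 := by
    rcases hl.strip with h | h
    · exact key _ _ h hl
    · exact (key _ _ h hl.symm).symm
  obtain ⟨_, _, h⟩ := hl'
  exact h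

/-- A perfect matching containing `u_{2k+1} v_{2k+1}` for all `k` with `j ≤ k < n` has a forcing
set with at most `n + j` edges. -/
theorem exists_forcingSet_card_le (hM : M.IsPerfectMatching) {j : ℕ} (hj : j ≤ n)
    (h : ∀ k, j ≤ k → k < n → ind M (.u (2 * k + 1)) (.v (2 * k + 1)) = 1) :
    ∃ S : Finset (Sym2 {a : Label // IsVertex n a}),
      IsForcingSet M (S : Set (Sym2 {a : Label // IsVertex n a})) ∧ S.card ≤ n + j := by
  classical
  choose m hm using fun a => (SimpleGraph.Subgraph.isPerfectMatching_iff.1 hM a).exists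
  let x : Fin n → {a : Label // IsVertex n a} :=
    fun k => ⟨.u (2 * k + 1), by have := k.2; simp only [IsVertex]; omega⟩
  let y : Fin j → {a : Label // IsVertex n a} :=
    fun k => ⟨.v (2 * k + 2), by have := k.2; simp only [IsVertex]; omega⟩
  have agree : ∀ M' : (polyominoGraph n).Subgraph, M'.IsPerfectMatching → ∀ a,
      s(a, m a) ∈ M'.edgeSet → ∀ c, ind M a.1 c = ind M' a.1 c := by
    intro M' hM' a ha c
    exact ind_eq_of_common_edge hM hM' (b := (m a).1) ⟨a.2, (m a).2, hm a⟩
      ⟨a.2, (m a).2, ha⟩ c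
  refine ⟨univ.image (fun k => s(x k, m (x k))) ∪ univ.image (fun k => s(y k, m (y k))),
    ⟨?_, ?_⟩, ?_⟩
  · intro e he
    simp only [coe_union, coe_image, coe_univ, Set.image_univ, Set.mem_union, Set.mem_range] at he
    obtain ⟨k, rfl⟩ | ⟨k, rfl⟩ := he <;> exact hm _
  · intro M' hM' hS
    refine eq_of_agree hM hM' ?_ ?_
    · intro k hk
      exact agree M' hM' (x ⟨k, hk⟩)
        (hS (mem_coe.2 (mem_union_left _ (mem_image_of_mem _ (mem_univ _)))))
    · intro k hk
      rcases lt_or_ge k j with hkj | hkj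
      · exact Or.inr (agree M' hM' (y ⟨k, hkj⟩)
          (hS (mem_coe.2 (mem_union_right _ (mem_image_of_mem _ (mem_univ _))))))
      · exact Or.inl (h k hkj hk)
  · refine (card_union_le _ _).trans (add_le_add ?_ ?_)
    · exact card_image_le.trans (by simp)
    · exact card_image_le.trans (by simp)

end Upper

/-! ### Counting the edges of a forcing set -/

section Lower

/-- The column of a label. -/
def Label.col : Label → ℕ
  | .w i => i
  | .u i => i
  | .v i => i
  | .z i => i

open Classical in
/-- The indicator of an edge in a set of pairs of labels. -/
noncomputable def edgeInd (T : Finset (Sym2 Label)) (a b : Label) : ℕ :=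
  if s(a, b) ∈ T then 1 else 0

open Classical in
/-- The number of edges of `T` up to column `c`. -/
noncomputable def edgeCount (T : Finset (Sym2 Label)) (c : ℕ) : ℕ :=
  #{e ∈ T | ∀ a ∈ e, a.col ≤ c}

theorem edgeCount_le_card (T : Finset (Sym2 Label)) (c : ℕ) : edgeCount T c ≤ #T := by
  classical
  exact card_filter_le _ _

theorem edgeInd_le_edgeCount_zero (T : Finset (Sym2 Label)) :
    edgeInd T (.u 0) (.v 0) ≤ edgeCount T 0 := by
  classical
  unfold edgeInd
  split_ifs with h
  · refine card_pos.2 ⟨s(.u 0, .v 0), ?_⟩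
    simp [h, Label.col]
  · exact Nat.zero_le _

/-- The edges of block `k`, with the links to the previous block. -/
theorem edgeCount_succ_block (T : Finset (Sym2 Label)) (k : ℕ) :
    edgeCount T (2 * k) +
      (edgeInd T (.u (2 * k)) (.u (2 * k + 1)) + edgeInd T (.v (2 * k)) (.v (2 * k + 1)) +
      edgeInd T (.w (2 * k + 1)) (.u (2 * k + 1)) + edgeInd T (.w (2 * k + 2)) (.u (2 * k + 2)) +
      edgeInd T (.u (2 * k + 1)) (.v (2 * k + 1)) + edgeInd T (.u (2 * k + 2)) (.v (2 * k + 2)) +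
      edgeInd T (.v (2 * k + 1)) (.z (2 * k + 1)) + edgeInd T (.v (2 * k + 2)) (.z (2 * k + 2)) +
      edgeInd T (.w (2 * k + 1)) (.w (2 * k + 2)) + edgeInd T (.u (2 * k + 1)) (.u (2 * k + 2)) +
      edgeInd T (.v (2 * k + 1)) (.v (2 * k + 2)) + edgeInd T (.z (2 * k + 1)) (.z (2 * k + 2)))
      ≤ edgeCount T (2 * k + 2) := by
  classical
  let B : Finset (Sym2 Label) :=
    {s(.u (2 * k), .u (2 * k + 1)), s(.v (2 * k), .v (2 * k + 1)),
      s(.w (2 * k + 1), .u (2 * k + 1)), s(.w (2 * k + 2), .u (2 * k + 2)),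
      s(.u (2 * k + 1), .v (2 * k + 1)), s(.u (2 * k + 2), .v (2 * k + 2)),
      s(.v (2 * k + 1), .z (2 * k + 1)), s(.v (2 * k + 2), .z (2 * k + 2)),
      s(.w (2 * k + 1), .w (2 * k + 2)), s(.u (2 * k + 1), .u (2 * k + 2)),
      s(.v (2 * k + 1), .v (2 * k + 2)), s(.z (2 * k + 1), .z (2 * k + 2))}
  have hB : #{e ∈ B | e ∈ T} = ∑ e ∈ B, if e ∈ T then 1 else 0 := card_filter _ _
  -- An endpoint right of column `2k` keeps these edges out of `edgeCount T (2 * k)`.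
  have hB' : ∀ e ∈ B, (∃ a ∈ e, 2 * k < a.col) ∧ ∀ a ∈ e, a.col ≤ 2 * k + 2 := by
    intro e he
    simp only [B, mem_insert, mem_singleton] at he
    rcases he with rfl | rfl | rfl | rfl | rfl | rfl | rfl | rfl | rfl | rfl | rfl | rfl <;>
      simp [Label.col]
  have hdisj : Disjoint ({e ∈ T | ∀ a ∈ e, a.col ≤ 2 * k} : Finset (Sym2 Label))
      ({e ∈ B | e ∈ T} : Finset (Sym2 Label)) := by
    rw [disjoint_left]
    intro e he he'
    obtain ⟨a, ha, hak⟩ := (hB' e (mem_filter.1 he').1).1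
    exact absurd ((mem_filter.1 he).2 a ha) (by omega)
  have hsum : ∑ e ∈ B, (if e ∈ T then 1 else 0) =
      edgeInd T (.u (2 * k)) (.u (2 * k + 1)) + edgeInd T (.v (2 * k)) (.v (2 * k + 1)) +
      edgeInd T (.w (2 * k + 1)) (.u (2 * k + 1)) + edgeInd T (.w (2 * k + 2)) (.u (2 * k + 2)) +
      edgeInd T (.u (2 * k + 1)) (.v (2 * k + 1)) + edgeInd T (.u (2 * k + 2)) (.v (2 * k + 2)) +
      edgeInd T (.v (2 * k + 1)) (.z (2 * k + 1)) + edgeInd T (.v (2 * k + 2)) (.z (2 * k + 2)) +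
      edgeInd T (.w (2 * k + 1)) (.w (2 * k + 2)) + edgeInd T (.u (2 * k + 1)) (.u (2 * k + 2)) +
      edgeInd T (.v (2 * k + 1)) (.v (2 * k + 2)) +
      edgeInd T (.z (2 * k + 1)) (.z (2 * k + 2)) := by
    simp only [B]
    repeat rw [sum_insert (by simp)]
    rw [sum_singleton]
    simp only [edgeInd, add_assoc]
  rw [← hsum, ← hB]
  unfold edgeCount
  rw [← card_union_of_disjoint hdisj]
  refine card_le_card fun e he => ?_
  rcases mem_union.1 he with he | he
  · obtain ⟨h1, h2⟩ := mem_filter.1 he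
    exact mem_filter.2 ⟨h1, fun a ha => (h2 a ha).trans (by omega)⟩
  · obtain ⟨h1, h2⟩ := mem_filter.1 he
    exact mem_filter.2 ⟨h2, (hB' e h1).2⟩

/-! ### Lower bound: scanning the blocks -/

variable {n : ℕ} {M : (polyominoGraph n).Subgraph}

open Classical in
/-- The edge set on labels underlying an edge set of `G_n`. -/
noncomputable def labelEdges (S : Finset (Sym2 {a : Label // IsVertex n a})) :
    Finset (Sym2 Label) :=
  S.image (Sym2.map Subtype.val)

theorem card_labelEdges_le (S : Finset (Sym2 {a : Label // IsVertex n a})) :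
    #(labelEdges S) ≤ #S := by
  classical
  exact card_image_le

/-- Label form of `IsForcingSet.mem_of_alternating_square`, with the matched sides written in
parallel as `ab` and `dc`, so that `omega` can add it to the edge counts. -/
theorem edgeInd_square {S : Finset (Sym2 {a : Label // IsVertex n a})}
    (hM : M.IsPerfectMatching)
    (hS : IsForcingSet M (S : Set (Sym2 {a : Label // IsVertex n a}))) {a b c d : Label}
    (hbc : StripEdge b c ∨ StripEdge c b) (hda : StripEdge d a ∨ StripEdge a d) (hac : a ≠ c)
    (hab : ind M a b = 1) (hcd : ind M d c = 1) :
    1 ≤ edgeInd (labelEdges S) a b + edgeInd (labelEdges S) d c := by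
  classical
  obtain ⟨ha, hb, hab⟩ := ind_eq_one_iff.1 hab
  obtain ⟨hd, hc, hcd⟩ := ind_eq_one_iff.1 hcd
  have hmem : ∀ x y : {a : Label // IsVertex n a}, s(x, y) ∈ S →
      edgeInd (labelEdges S) x.1 y.1 = 1 := fun x y h =>
    if_pos (mem_image.2 ⟨s(x, y), h, rfl⟩)
  rcases hS.mem_of_alternating_square hM hab hcd.symm hbc hda (fun h => hac (congrArg Subtype.val h))
    with h | h
  · have := hmem _ _ h
    simp only at this
    omega
  · have := hmem _ _ (Sym2.eq_swap ▸ h)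
    simp only at this
    omega

/-- The possible restrictions of a perfect matching to a block. -/
theorem block_cases (hM : M.IsPerfectMatching) {k : ℕ} (hk : k < n) :
    ind M (.u (2 * k)) (.u (2 * k + 1)) = 1 ∧
      (ind M (.u (2 * k + 2)) (.u (2 * k + 3)) = 0 →
        ind M (.u (2 * k + 2)) (.v (2 * k + 2)) = 1) ∨
    ind M (.u (2 * k)) (.u (2 * k + 1)) = 0 ∧ ind M (.u (2 * k + 1)) (.v (2 * k + 1)) = 1 ∧
      (ind M (.u (2 * k + 2)) (.u (2 * k + 3)) = 0 →
        ind M (.u (2 * k + 2)) (.v (2 * k + 2)) = 1) ∨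
    (ind M (.w (2 * k + 1)) (.w (2 * k + 2)) = 1 ∧ ind M (.u (2 * k + 1)) (.u (2 * k + 2)) = 1 ∨
      ind M (.w (2 * k + 1)) (.u (2 * k + 1)) = 1 ∧
        ind M (.w (2 * k + 2)) (.u (2 * k + 2)) = 1) ∧
    (ind M (.v (2 * k + 1)) (.v (2 * k + 2)) = 1 ∧ ind M (.z (2 * k + 1)) (.z (2 * k + 2)) = 1 ∨
      ind M (.v (2 * k + 1)) (.z (2 * k + 1)) = 1 ∧
        ind M (.v (2 * k + 2)) (.z (2 * k + 2)) = 1) := by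
  have p := ind_link_eq hM (by omega) hk.le
  have h1 := sum_ind_w_left hM hk
  have h2 := sum_ind_w_right hM hk
  have h3 := sum_ind_z_left hM hk
  have h4 := sum_ind_z_right hM hk
  have h5 := sum_ind_u hM (i := 2 * k) (by omega)
  have h6 := sum_ind_u hM (i := 2 * k + 1) (by omega)
  have h7 := sum_ind_v hM (i := 2 * k) (by omega)
  have h8 := sum_ind_v hM (i := 2 * k + 1) (by omega)
  simp only [add_assoc, Nat.reduceAdd] at *
  -- Split by whether `u_{2k+1}` is covered by the left link, by `v_{2k+1}`, or inside the upper
  -- outer square.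
  rcases Nat.le_one_iff_eq_zero_or_eq_one.1
    (ind_le_one (M := M) (.u (2 * k)) (.u (2 * k + 1))) with d1 | d1
  · rcases Nat.le_one_iff_eq_zero_or_eq_one.1
      (ind_le_one (M := M) (.u (2 * k + 1)) (.v (2 * k + 1))) with d2 | d2
    · exact Or.inr (Or.inr ⟨by omega, by omega⟩)
    · exact Or.inr (Or.inl ⟨d1, d2, by omega⟩)
  · exact Or.inl ⟨d1, by omega⟩

/-- The bound `k` alone is not inductive: a block with vertical first column and a right link has no
alternating square of its own. Hence the second clause: without a link after column `2k` there is
either a surplus edge, or a vertical edge at column `2k` that can close a square with the next block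
and, if in `S`, is counted beyond `k`. -/
theorem edgeCount_lower_bound {S : Finset (Sym2 {a : Label // IsVertex n a})}
    (hM : M.IsPerfectMatching)
    (hS : IsForcingSet M (S : Set (Sym2 {a : Label // IsVertex n a}))) (hn : 0 < n) {k : ℕ}
    (hk : k ≤ n) :
    k ≤ edgeCount (labelEdges S) (2 * k) ∧ (ind M (.u (2 * k)) (.u (2 * k + 1)) = 0 →
      k + 1 ≤ edgeCount (labelEdges S) (2 * k) ∨ ind M (.u (2 * k)) (.v (2 * k)) = 1 ∧
        k + edgeInd (labelEdges S) (.u (2 * k)) (.v (2 * k)) ≤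
          edgeCount (labelEdges S) (2 * k)) := by
  induction k with
  | zero =>
    have h := sum_ind_u_zero hM hn
    have h' := edgeInd_le_edgeCount_zero (labelEdges S)
    simp only [mul_zero, zero_add]
    omega
  | succ k ih =>
    obtain ⟨ih0, ih⟩ := ih (by omega)
    have hc := edgeCount_succ_block (labelEdges S) k
    rw [mul_add, mul_one]
    rcases block_cases hM hk with ⟨hl, hr⟩ | ⟨hl, hv, hr⟩ | ⟨hw, hz⟩
    -- Both left links are in `M`: their square pays for the block.
    · have q := edgeInd_square hM hS (c := .v (2 * k + 1)) (.inl (.uv (2 * k + 1)))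
        (.inr (.uv (2 * k))) (by simp) hl ((ind_link_eq hM hn (by omega)).symm.trans hl)
      exact ⟨by omega, fun h => Or.inr ⟨hr h, by omega⟩⟩
    · have q := edgeInd_square hM hS (a := .u (2 * k + 1)) (c := .v (2 * k + 2))
        (d := .u (2 * k + 2)) (.inl (.vv (2 * k + 1))) (.inr (.uu (2 * k + 1))) (by simp) hv
      -- A surplus edge pays for the block, and with no right link its middle square restores the
      -- surplus. Otherwise the square between columns `2k` and `2k+1` pays.
      rcases ih hl with ih | ⟨hv', ih⟩
      · refine ⟨by omega, fun h => Or.inl ?_⟩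
        have := q (hr h)
        omega
      · have q' := edgeInd_square hM hS (c := .v (2 * k + 1)) (.inl (.vv (2 * k)))
          (.inr (.uu (2 * k))) (by simp) hv' hv
        exact ⟨by omega, fun h => Or.inr ⟨hr h, by omega⟩⟩
    -- Both outer squares alternate: two new edges, hence a surplus.
    · have q1 : 1 ≤ edgeInd (labelEdges S) (.w (2 * k + 1)) (.w (2 * k + 2)) +
          edgeInd (labelEdges S) (.u (2 * k + 1)) (.u (2 * k + 2)) +
          edgeInd (labelEdges S) (.w (2 * k + 1)) (.u (2 * k + 1)) +
          edgeInd (labelEdges S) (.w (2 * k + 2)) (.u (2 * k + 2)) := by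
        rcases hw with ⟨h, h'⟩ | ⟨h, h'⟩
        · have := edgeInd_square hM hS (.inl (.wu (2 * k + 2))) (.inr (.wu (2 * k + 1)))
            (by simp) h h'
          omega
        · have := edgeInd_square hM hS (d := .w (2 * k + 2)) (c := .u (2 * k + 2))
            (.inl (.uu (2 * k + 1))) (.inr (.ww k)) (by simp) h h'
          omega
      have q2 : 1 ≤ edgeInd (labelEdges S) (.v (2 * k + 1)) (.v (2 * k + 2)) +
          edgeInd (labelEdges S) (.z (2 * k + 1)) (.z (2 * k + 2)) +
          edgeInd (labelEdges S) (.v (2 * k + 1)) (.z (2 * k + 1)) +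
          edgeInd (labelEdges S) (.v (2 * k + 2)) (.z (2 * k + 2)) := by
        rcases hz with ⟨h, h'⟩ | ⟨h, h'⟩
        · have := edgeInd_square hM hS (.inl (.vz (2 * k + 2))) (.inr (.vz (2 * k + 1)))
            (by simp) h h'
          omega
        · have := edgeInd_square hM hS (d := .v (2 * k + 2)) (c := .z (2 * k + 2))
            (.inl (.zz k)) (.inr (.vv (2 * k + 1))) (by simp) h h'
          omega
      exact ⟨by omega, fun h => Or.inl (by omega)⟩

end Lower

/-! ### Perfect matchings with prescribed forcing number -/

section Interpolation

variable {n : ℕ}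

/-- Exchanges `2k+1` and `2k+2`. -/
def pairIndex (i : ℕ) : ℕ := if i % 2 = 1 then i + 1 else i - 1

/-- The partners in the perfect matching consisting of the horizontal edges of the first `j`
blocks, and in the other columns of the edges `u_i v_i` and the outer horizontal edges. -/
def partner (j : ℕ) : Label → Label
  | .w i => .w (pairIndex i)
  | .z i => .z (pairIndex i)
  | .u i => if 1 ≤ i ∧ i ≤ 2 * j then .u (pairIndex i) else .v i
  | .v i => if 1 ≤ i ∧ i ≤ 2 * j then .v (pairIndex i) else .u i

theorem pairIndex_spec {i : ℕ} (h : 1 ≤ i) :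
    ∃ k, (i = 2 * k + 1 ∧ pairIndex i = 2 * k + 2) ∨ (i = 2 * k + 2 ∧ pairIndex i = 2 * k + 1) := by
  refine ⟨(i - 1) / 2, ?_⟩
  unfold pairIndex
  split_ifs <;> omega

theorem pairIndex_pairIndex {i : ℕ} (h : 1 ≤ i) : pairIndex (pairIndex i) = i := by
  unfold pairIndex
  split_ifs <;> omega

theorem pairIndex_mem {i m : ℕ} (h : 1 ≤ i ∧ i ≤ 2 * m) :
    1 ≤ pairIndex i ∧ pairIndex i ≤ 2 * m := by
  unfold pairIndex
  split_ifs <;> omega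

theorem isVertex_partner {j : ℕ} (hj : j ≤ n) {a : Label} (ha : IsVertex n a) :
    IsVertex n (partner j a) := by
  cases a with
  | w i => exact pairIndex_mem ha
  | z i => exact pairIndex_mem ha
  | u i =>
    simp only [partner]
    split_ifs with h
    · have := pairIndex_mem h
      exact ⟨ha.1, by omega⟩
    · exact ha
  | v i =>
    simp only [partner]
    split_ifs with h
    · have := pairIndex_mem h
      exact ⟨ha.1, by omega⟩
    · exact ha

theorem partner_partner (j : ℕ) {a : Label} (ha : IsVertex n a) :
    partner j (partner j a) = a := by
  cases a with
  | w i => simp only [partner, pairIndex_pairIndex ha.1]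
  | z i => simp only [partner, pairIndex_pairIndex ha.1]
  | u i =>
    by_cases h : 1 ≤ i ∧ i ≤ 2 * j
    · simp only [partner, if_pos h, if_pos (pairIndex_mem h), pairIndex_pairIndex h.1]
    · simp only [partner, if_neg h]
  | v i =>
    by_cases h : 1 ≤ i ∧ i ≤ 2 * j
    · simp only [partner, if_pos h, if_pos (pairIndex_mem h), pairIndex_pairIndex h.1]
    · simp only [partner, if_neg h]

theorem strip_partner (j : ℕ) {a : Label} (ha : IsVertex n a) :
    StripEdge a (partner j a) ∨ StripEdge (partner j a) a := by
  cases a with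
  | w i =>
    simp only [partner]
    obtain ⟨k, ⟨h1, h2⟩ | ⟨h1, h2⟩⟩ := pairIndex_spec ha.1 <;> rw [h2, h1]
    exacts [.inl (.ww k), .inr (.ww k)]
  | z i =>
    simp only [partner]
    obtain ⟨k, ⟨h1, h2⟩ | ⟨h1, h2⟩⟩ := pairIndex_spec ha.1 <;> rw [h2, h1]
    exacts [.inl (.zz k), .inr (.zz k)]
  | u i =>
    simp only [partner]
    split_ifs with h
    · obtain ⟨k, ⟨h1, h2⟩ | ⟨h1, h2⟩⟩ := pairIndex_spec h.1 <;> rw [h2, h1]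
      exacts [.inl (.uu _), .inr (.uu _)]
    · exact .inl (.uv i)
  | v i =>
    simp only [partner]
    split_ifs with h
    · obtain ⟨k, ⟨h1, h2⟩ | ⟨h1, h2⟩⟩ := pairIndex_spec h.1 <;> rw [h2, h1]
      exacts [.inl (.vv _), .inr (.vv _)]
    · exact .inr (.uv i)

/-- The perfect matching of `G_n` defined by `partner j`. -/
def partnerMatching (n j : ℕ) : (polyominoGraph n).Subgraph where
  verts := Set.univ
  Adj a b := partner j a.1 = b.1
  adj_sub {a b} h := by
    have := strip_partner j a.2
    rwa [h] at this
  edge_vert _ := Set.mem_univ _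
  symm := ⟨fun a b h => by rw [← h, partner_partner j a.2]⟩

theorem partnerMatching_isPerfectMatching {j : ℕ} (hj : j ≤ n) :
    (partnerMatching n j).IsPerfectMatching := by
  rw [SimpleGraph.Subgraph.isPerfectMatching_iff]
  intro a
  exact ⟨⟨partner j a.1, isVertex_partner hj a.2⟩, rfl, fun b hb =>
    Subtype.ext (show partner j a.1 = b.1 from hb).symm⟩

theorem ind_partnerMatching {j : ℕ} {a b : Label} (ha : IsVertex n a) (hb : IsVertex n b)
    (h : partner j a = b) : ind (partnerMatching n j) a b = 1 :=
  ind_eq_one_iff.2 ⟨ha, hb, h⟩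

theorem pairIndex_odd (k : ℕ) : pairIndex (2 * k + 1) = 2 * k + 2 := by
  unfold pairIndex
  split_ifs <;> omega

theorem ind_partnerMatching_vertical {j k : ℕ} (hjk : j ≤ k) (hk : k < n) :
    ind (partnerMatching n j) (.u (2 * k + 1)) (.v (2 * k + 1)) = 1 ∧
      ind (partnerMatching n j) (.u (2 * k + 2)) (.v (2 * k + 2)) = 1 := by
  constructor <;> refine ind_partnerMatching ?_ ?_ (if_neg (by omega)) <;>
    simp only [IsVertex] <;> omega

theorem ind_partnerMatching_horizontal {j k : ℕ} (hkj : k < j) (hj : j ≤ n) :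
    ind (partnerMatching n j) (.u (2 * k + 1)) (.u (2 * k + 2)) = 1 ∧
      ind (partnerMatching n j) (.v (2 * k + 1)) (.v (2 * k + 2)) = 1 ∧
      ind (partnerMatching n j) (.w (2 * k + 1)) (.w (2 * k + 2)) = 1 ∧
      ind (partnerMatching n j) (.z (2 * k + 1)) (.z (2 * k + 2)) = 1 := by
  refine ⟨?_, ?_, ?_, ?_⟩ <;> refine ind_partnerMatching ?_ ?_ ?_
  case refine_1.refine_3 => simp only [partner, pairIndex_odd]; exact if_pos (by omega)
  case refine_2.refine_3 => simp only [partner, pairIndex_odd]; exact if_pos (by omega)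
  case refine_3.refine_3 => simp only [partner, pairIndex_odd]
  case refine_4.refine_3 => simp only [partner, pairIndex_odd]
  all_goals simp only [IsVertex]; omega

/-- Each of the first `j` blocks contributes its two outer squares, each later block its middle
square; hence `min k j` counts the extra edges. -/
theorem edgeCount_partnerMatching {S : Finset (Sym2 {a : Label // IsVertex n a})} {j : ℕ}
    (hj : j ≤ n) (hS : IsForcingSet (partnerMatching n j)
      (S : Set (Sym2 {a : Label // IsVertex n a}))) {k : ℕ} (hk : k ≤ n) :
    k + min k j ≤ edgeCount (labelEdges S) (2 * k) := by
  have hM := partnerMatching_isPerfectMatching hj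
  induction k with
  | zero => simp
  | succ k ih =>
    have ih := ih (by omega)
    have hc := edgeCount_succ_block (labelEdges S) k
    rcases lt_or_ge k j with hkj | hkj
    · obtain ⟨hu, hv, hw, hz⟩ := ind_partnerMatching_horizontal hkj hj
      have q1 := edgeInd_square hM hS (a := .w (2 * k + 1)) (b := .w (2 * k + 2))
        (c := .u (2 * k + 2)) (d := .u (2 * k + 1))
        (.inl (.wu (2 * k + 2))) (.inr (.wu (2 * k + 1))) (by simp) hw hu
      have q2 := edgeInd_square hM hS (a := .v (2 * k + 1)) (b := .v (2 * k + 2))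
        (c := .z (2 * k + 2)) (d := .z (2 * k + 1))
        (.inl (.vz (2 * k + 2))) (.inr (.vz (2 * k + 1))) (by simp) hv hz
      rw [mul_add, mul_one]
      omega
    · obtain ⟨h1, h2⟩ := ind_partnerMatching_vertical hkj hk
      have q := edgeInd_square hM hS (a := .u (2 * k + 1)) (b := .v (2 * k + 1))
        (c := .v (2 * k + 2)) (d := .u (2 * k + 2))
        (.inl (.vv (2 * k + 1))) (.inr (.uu (2 * k + 1))) (by simp) h1 h2
      rw [mul_add, mul_one]
      omega

end Interpolation

/-! ### The forcing spectrum -/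

section Spectrum

variable {n : ℕ} {M : (polyominoGraph n).Subgraph}

theorem forcingNumber_le (hM : M.IsPerfectMatching) {j : ℕ} (hj : j ≤ n)
    (h : ∀ k, j ≤ k → k < n → ind M (.u (2 * k + 1)) (.v (2 * k + 1)) = 1) :
    forcingNumber M ≤ n + j := by
  obtain ⟨S, hS, hc⟩ := exists_forcingSet_card_le hM hj h
  exact le_trans (Nat.sInf_le ⟨S, hS, rfl⟩) hc

theorem le_forcingNumber (hM : M.IsPerfectMatching) {m : ℕ}
    (h : ∀ S : Finset (Sym2 {a : Label // IsVertex n a}),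
      IsForcingSet M (S : Set (Sym2 {a : Label // IsVertex n a})) → m ≤ #S) :
    m ≤ forcingNumber M := by
  -- A forcing set must exist, since `sInf ∅ = 0`. For `j = n` the condition on the blocks is
  -- vacuous.
  obtain ⟨S, hS, -⟩ := exists_forcingSet_card_le hM le_rfl (fun k h h' => by omega)
  refine le_csInf ⟨_, S, hS, rfl⟩ ?_
  rintro _ ⟨T, hT, rfl⟩
  exact h T hT

theorem forcingNumber_mem_Icc (hM : M.IsPerfectMatching) :
    forcingNumber M ∈ Set.Icc n (2 * n) := by
  refine ⟨?_, ?_⟩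
  -- The null graph is separate: the scan starts at column 0, which it lacks.
  · rcases n.eq_zero_or_pos with rfl | hn
    · exact Nat.zero_le _
    · exact le_forcingNumber hM fun S hS => (edgeCount_lower_bound hM hS hn le_rfl).1.trans
        ((edgeCount_le_card _ _).trans (card_labelEdges_le S))
  · rw [two_mul]
    exact forcingNumber_le hM le_rfl fun k h h' => by omega

theorem forcingNumber_partnerMatching {j : ℕ} (hj : j ≤ n) :
    forcingNumber (partnerMatching n j) = n + j := by
  have hM := partnerMatching_isPerfectMatching hj
  refine le_antisymm (forcingNumber_le hM hj fun k h h' => (ind_partnerMatching_vertical h h').1)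
    (le_forcingNumber hM fun S hS => ?_)
  have h := edgeCount_partnerMatching hj hS le_rfl
  rw [min_eq_right hj] at h
  exact h.trans ((edgeCount_le_card _ _).trans (card_labelEdges_le S))

theorem forcingSpectrum_polyominoGraph (n : ℕ) :
    forcingSpectrum (polyominoGraph n) = Set.Icc n (2 * n) := by
  ext m
  constructor
  · rintro ⟨M, hM, rfl⟩
    exact forcingNumber_mem_Icc hM
  · rintro ⟨h1, h2⟩
    obtain ⟨j, rfl⟩ := Nat.exists_eq_add_of_le h1
    have hj : j ≤ n := by omega
    exact ⟨_, partnerMatching_isPerfectMatching hj, forcingNumber_partnerMatching hj⟩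

end Spectrum

end ForcingSpectrum

/-- The minimum forcing number of `G_n` is `n`, the maximum forcing number is `2n`, and the forcing
spectrum of `G_n` is the full integer interval `[n, 2n]`. -/
theorem corollary3p3 (n : ℕ) :
    (IsLeast (ForcingSpectrum.forcingSpectrum (ForcingSpectrum.polyominoGraph n)) n ∧
      IsGreatest (ForcingSpectrum.forcingSpectrum (ForcingSpectrum.polyominoGraph n)) (2 * n)) ∧
    ForcingSpectrum.forcingSpectrum (ForcingSpectrum.polyominoGraph n) = Set.Icc n (2 * n) := by
  rw [ForcingSpectrum.forcingSpectrum_polyominoGraph]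
  have h : n ≤ 2 * n := Nat.le_mul_of_pos_left n two_pos
  exact ⟨⟨isLeast_Icc h, isGreatest_Icc h⟩, rfl⟩
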